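/- Let $E$ be a Lusin topological space (a homeomorph of a Borel subset of a compact metric space), let $M(E)$ be the space of finite Borel measures on $E$ with the topology of weak convergence and its Borel $\sigma$-algebra, and let $B(E)^+$ be the set of bounded nonnegative Borel functions on $E$. Write $\nu(f)=\int_E f\,d\nu$, and $L_P(f)=\int_{M(E)} e^{-\nu(f)}P(d\nu)$ for a probability measure $P$ on $M(E)$ and $f\in B(E)^+$. Let $(Q_t)_{t\ge 0}$ be the transition semigroup of a measure-valued branching process: a conservative (Markov) transition semigroup on $M(E)$ with $\int_{M(E)} e^{-\nu(f)}Q_t(\mu,d\nu)=e^{-\mu(V_tf)}$ for all $t\ge 0$, $\mu\in M(E)$, $f\in B(E)^+$, where $V_tf(x)=-\log\int_{M(E)} e^{-\nu(f)}Q_t(\delta_x,d\nu)$. Suppose that for each $t>0$ the function $\bar V_t(x):=\lim_{\lambda\to\infty}V_t\lambda(x)$ (where $\lambda$ also denotes the constant function) is bounded on $E$. Let $(K_s)_{s>0}$ be an infinitely divisible probability entrance law for $(Q_t)_{t\ge 0}$, i.e. each $K_s$ is an infinitely divisible probability measure on $M(E)$ and $K_sQ_r=K_{s+r}$ for $s>0$,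 $r\ge 0$. Let $(N_t)_{t\ge 0}$ be the skew convolution semigroup (a family of probability measures on $M(E)$ with $N_{r+t}=(N_rQ_t)*N_t$ for $r,t\ge 0$) represented by $(K_s)_{s>0}$, that is, for all $t\ge 0$ and $f\in B(E)^+$, $$L_{N_t}(f)=\exp\Big\{\int_0^t \log L_{K_s}(f)\,ds\Big\},$$ where the function $s\mapsto \log L_{K_s}(f)$ is integrable on $(0,t]$. Suppose that $$\int_0^\infty ds\int_{M(E)}\nu(1)\,K_s(d\nu)<\infty .$$ Then $N_t$ converges weakly, as $t\to\infty$, to a probability measure $N_\infty$ on $M(E)$, and for every $t>0$ $$\|N_t-N_\infty\|_{\mathrm{var}}\;\le\; 2\int_{M(E)}\big(1-e^{-\nu(\bar V_t)}\big)N_\infty(d\nu)\;\le\; 2\int_{M(E)}\nu(\bar V_t)\,N_\infty(d\nu),$$ where $\|P-R\|_{\mathrm{var}}=|P-R|(M(E))$ is the total mass of the total variation measure of the signed measure $P-R$. -/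

import Mathlib

open MeasureTheory ProbabilityTheory Filter Topology
open scoped NNReal ENNReal BoundedContinuousFunction

universe u

/-- A Lusin topological space: a space homeomorphic to a Borel subset of a compact metric space. -/
class LusinSpace (E : Type u) [TopologicalSpace E] : Prop where
  exists_embedding : ∃ (K : Type u) (_ : MetricSpace K) (_ : CompactSpace K) (e : E → K),
    IsEmbedding e ∧ MeasurableSet[borel K] (Set.range e)

/-! The space `M(E)` of finite Borel measures is Mathlib's `FiniteMeasure E` with the topology of
weak convergence. Mathlib equips it with the σ-algebra generated by the evaluations `ν ↦ ν A`. The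
following section proves that, for a Lusin space `E`, this is the Borel σ-algebra of the weak
topology. -/

section WeakTopology

variable {E : Type u}

noncomputable def weakCone [MetricSpace E] (s : Set E) (i : s × ℕ × ℚ) (x : E) : ℝ≥0 :=
  Real.toNNReal (i.2.2 - i.2.1 * dist x i.1)

noncomputable def weakConeSup [MetricSpace E] (s : Set E) (j : Finset (s × ℕ × ℚ)) (x : E) : ℝ≥0 :=
  j.sup fun i => weakCone s i x

theorem continuous_weakConeSup [MetricSpace E] (s : Set E) (j : Finset (s × ℕ × ℚ)) :
    Continuous (weakConeSup s j) := by
  unfold weakConeSup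
  apply Continuous.finset_sup_apply
  intro i _
  unfold weakCone
  fun_prop

theorem iSup_weakConeSup [MetricSpace E] {s : Set E} (hs : Dense s) {f : E → ℝ≥0} (hf : Continuous f)
    (x : E) :
    ⨆ j : {j : Finset (s × ℕ × ℚ) // ∀ y, weakConeSup s j y ≤ f y}, (weakConeSup s j x : ℝ≥0∞) = f x := by
  apply le_antisymm
  · exact iSup_le fun j => by exact_mod_cast j.2 x
  · refine le_of_forall_lt fun c hc => ?_
    lift c to ℝ≥0 using (hc.trans ENNReal.coe_lt_top).ne
    have hc' : (c : ℝ) < f x := by exact_mod_cast hc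
    obtain ⟨q, hq1, hq2⟩ := exists_rat_btwn hc'
    have hnh : ∀ᶠ y in 𝓝 x, (q : ℝ) < f y :=
      (NNReal.continuous_coe.comp hf).continuousAt.eventually (lt_mem_nhds hq2)
    obtain ⟨δ, hδ, hball⟩ := Metric.eventually_nhds_iff.1 hnh
    have hq0 : (0 : ℝ) < q := c.2.trans_lt hq1
    obtain ⟨r, hr⟩ := exists_nat_gt (2 * q / δ)
    have hr0 : (0 : ℝ) < r := lt_trans (by positivity) hr
    have hε : 0 < min (δ / 2) ((q - c) / r) := lt_min (by positivity) (by
      apply div_pos _ hr0; linarith)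
    obtain ⟨y, hys, hy⟩ := Metric.mem_closure_iff.1 (hs x) _ hε
    have hyδ : dist x y < δ / 2 := hy.trans_le (min_le_left _ _)
    have hyq : dist x y < (q - c) / r := hy.trans_le (min_le_right _ _)
    rw [lt_div_iff₀ hr0] at hyq
    rw [div_lt_iff₀ hδ] at hr
    let i : s × ℕ × ℚ := (⟨y, hys⟩, r, q)
    have hi : ∀ z, weakConeSup s {i} z ≤ f z := by
      intro z
      simp only [weakConeSup, Finset.sup_singleton, weakCone, i]
      rw [Real.toNNReal_le_iff_le_coe]
      by_cases hz : dist z x < δ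
      · have := hball hz
        have h2 : 0 ≤ (r : ℝ) * dist z y := by positivity
        linarith
      · have h1 : δ / 2 ≤ dist z y := by
          have := dist_triangle z y x
          rw [dist_comm y x] at this
          linarith
        have h2 : (r : ℝ) * (δ / 2) ≤ r * dist z y := by gcongr
        have h3 : (0 : ℝ) ≤ f z := (f z).2
        linarith
    refine lt_of_lt_of_le ?_ (le_iSup (fun j : {j : Finset (s × ℕ × ℚ) // ∀ y, weakConeSup s j y ≤ f y}
      => (weakConeSup s j x : ℝ≥0∞)) ⟨{i}, hi⟩)
    rw [ENNReal.coe_lt_coe]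
    simp only [weakConeSup, Finset.sup_singleton, weakCone, i]
    rw [Real.lt_toNNReal_iff_coe_lt]
    linarith [mul_comm (dist x y) (r : ℝ)]

theorem tendsto_of_weakConeSup [MetricSpace E] [MeasurableSpace E] [BorelSpace E] {s : Set E}
    (hsc : s.Countable) (hs : Dense s) {γ : Type*} {F : Filter γ} {μs : γ → FiniteMeasure E}
    {μ : FiniteMeasure E} (hm : Tendsto (fun i => (μs i).mass) F (𝓝 μ.mass))
    (h : ∀ j, Tendsto (fun i => ∫⁻ x, weakConeSup s j x ∂(μs i : Measure E)) F
      (𝓝 (∫⁻ x, weakConeSup s j x ∂(μ : Measure E)))) :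
    Tendsto μs F (𝓝 μ) := by
  have := hsc.to_subtype
  have lsc : ∀ (f : E →ᵇ ℝ≥0) (a : ℝ), a < μ.testAgainstNN f →
      ∀ᶠ i in F, a < (μs i).testAgainstNN f := by
    intro f a ha
    rcases lt_or_ge a 0 with h0 | h0
    · exact Eventually.of_forall fun i => h0.trans_le (NNReal.coe_nonneg _)
    lift a to ℝ≥0 using h0
    have key : ∀ ν : FiniteMeasure E, ∫⁻ x, f x ∂(ν : Measure E) =
        ⨆ j : {j : Finset (s × ℕ × ℚ) // ∀ y, weakConeSup s j y ≤ f y},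
          ∫⁻ x, weakConeSup s j x ∂(ν : Measure E) := by
      intro ν
      rw [← lintegral_iSup_directed]
      · exact lintegral_congr fun x => (iSup_weakConeSup hs f.continuous x).symm
      · intro j
        exact (continuous_weakConeSup s j).measurable.coe_nnreal_ennreal.aemeasurable
      · classical
        intro j k
        refine ⟨⟨j.1 ∪ k.1, fun y => ?_⟩, fun y => ?_, fun y => ?_⟩
        · simp only [weakConeSup, Finset.sup_union]
          exact sup_le (j.2 y) (k.2 y)
        · exact ENNReal.coe_le_coe.2 (Finset.sup_mono Finset.subset_union_left)
        · exact ENNReal.coe_le_coe.2 (Finset.sup_mono Finset.subset_union_right)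
    have ha' : (a : ℝ≥0∞) < ∫⁻ x, f x ∂(μ : Measure E) := by
      rw [← FiniteMeasure.testAgainstNN_coe_eq]
      exact_mod_cast ha
    rw [key, lt_iSup_iff] at ha'
    obtain ⟨j, hj⟩ := ha'
    filter_upwards [(h j.1).eventually (lt_mem_nhds hj)] with i hi
    have : (a : ℝ≥0∞) < (μs i).testAgainstNN f := by
      rw [FiniteMeasure.testAgainstNN_coe_eq, key]
      exact hi.trans_le (le_iSup (fun j : {j : Finset (s × ℕ × ℚ) // ∀ y, weakConeSup s j y ≤ f y} =>
          ∫⁻ x, weakConeSup s j x ∂(μs i : Measure E)) j)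
    exact_mod_cast this
  rw [FiniteMeasure.tendsto_iff_forall_testAgainstNN_tendsto]
  intro f
  obtain ⟨c, hc⟩ : ∃ c : ℝ≥0, ∀ x, f x ≤ c := ⟨nndist 0 f, f.apply_le_nndist_zero⟩
  let g : E →ᵇ ℝ≥0 := BoundedContinuousFunction.const E c - f
  have hfg : f + g = BoundedContinuousFunction.const E c := by
    ext x
    simp only [g, BoundedContinuousFunction.coe_add, Pi.add_apply,
      BoundedContinuousFunction.coe_sub, Pi.sub_apply, BoundedContinuousFunction.const_apply]
    rw [add_tsub_cancel_of_le (hc x)]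
  have hsum : ∀ ν : FiniteMeasure E,
      (ν.testAgainstNN f : ℝ) + ν.testAgainstNN g = c * ν.mass := by
    intro ν
    rw [← NNReal.coe_add, ← FiniteMeasure.testAgainstNN_add, hfg, FiniteMeasure.testAgainstNN_const]
    simp
  rw [← NNReal.tendsto_coe]
  have hm' : Tendsto (fun i => (c : ℝ) * (μs i).mass) F (𝓝 (c * μ.mass)) :=
    ((NNReal.continuous_coe.tendsto _).comp hm).const_mul _
  refine tendsto_order.2 ⟨fun a ha => lsc f a ha, fun a ha => ?_⟩
  set ε := a - μ.testAgainstNN f with hε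
  have hεp : 0 < ε := by linarith
  filter_upwards [lsc g (μ.testAgainstNN g - ε / 2) (by linarith),
    hm'.eventually (gt_mem_nhds (show (c : ℝ) * μ.mass < c * μ.mass + ε / 2 by linarith))]
    with i h1 h2
  linarith [hsum (μs i), hsum μ]

instance FiniteMeasure.borelSpace_of_lusinSpace [TopologicalSpace E] [LusinSpace E] [MeasurableSpace E] [BorelSpace E] :
    BorelSpace (FiniteMeasure E) := by
  obtain ⟨K, _, _, e, he, -⟩ := LusinSpace.exists_embedding (E := E)
  let _ : MetricSpace E := he.comapMetricSpace
  have : SecondCountableTopology E := he.secondCountableTopology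
  obtain ⟨s, hsc, hs⟩ := TopologicalSpace.exists_countable_dense E
  have := hsc.to_subtype
  let Φ : FiniteMeasure E → ℝ≥0 × (Finset (s × ℕ × ℚ) → ℝ≥0∞) :=
    fun μ => (μ.mass, fun j => ∫⁻ x, weakConeSup s j x ∂(μ : Measure E))
  have hcoe : Measurable (fun μ : FiniteMeasure E => (μ : Measure E)) := measurable_subtype_coe
  have hΦ : Measurable Φ := by
    refine Measurable.prodMk ?_ (measurable_pi_lambda _ fun j => ?_)
    · exact ((Measure.measurable_coe MeasurableSet.univ).comp hcoe).ennreal_toNNReal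
    · exact (Measure.measurable_lintegral
        (continuous_weakConeSup s j).measurable.coe_nnreal_ennreal).comp hcoe
  refine ⟨le_antisymm ?_ ?_⟩
  · have hmeas : @Measurable (FiniteMeasure E) (Measure E) (borel _) _ FiniteMeasure.toMeasure := by
      let _ : MeasurableSpace (FiniteMeasure E) := borel _
      have _ : BorelSpace (FiniteMeasure E) := ⟨rfl⟩
      have hmass : Measurable fun μ : FiniteMeasure E => (μ : Measure E) Set.univ := by
        simp_rw [← FiniteMeasure.ennreal_mass]
        exact FiniteMeasure.continuous_mass.measurable.coe_nnreal_ennreal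
      refine Measurable.measure_of_isPiSystem
        (BorelSpace.measurable_eq.trans borel_eq_generateFrom_isClosed) isPiSystem_isClosed ?_ hmass
      intro A hA
      refine measurable_of_tendsto_metrizable (f := fun n (μ : FiniteMeasure E) =>
        ∫⁻ x, hA.apprSeq n x ∂(μ : Measure E)) (fun n => ?_) ?_
      · simp_rw [← FiniteMeasure.testAgainstNN_coe_eq]
        exact (FiniteMeasure.continuous_testAgainstNN_eval _).measurable.coe_nnreal_ennreal
      · rw [tendsto_pi_nhds]
        intro μ
        exact HasOuterApproxClosed.tendsto_lintegral_apprSeq hA (μ : Measure E)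
    exact Measurable.comap_le hmeas
  · have hle : TopologicalSpace.induced Φ inferInstance ≤
        (inferInstance : TopologicalSpace (FiniteMeasure E)) := by
      refine le_of_nhds_le_nhds fun μ => ?_
      have h0 : Tendsto Φ (@nhds _ (TopologicalSpace.induced Φ inferInstance) μ) (𝓝 (Φ μ)) := by
        rw [nhds_induced]; exact tendsto_comap
      refine tendsto_id'.1 (tendsto_of_weakConeSup hsc hs (μs := id) ((continuous_fst.tendsto _).comp h0) fun j => ?_)
      exact (((continuous_apply j).comp continuous_snd).tendsto _).comp h0
    calc borel (FiniteMeasure E) ≤ @borel _ (TopologicalSpace.induced Φ inferInstance) :=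
          borel_anti hle
      _ = (borel _).comap Φ := borel_comap
      _ ≤ _ := by
        rw [← BorelSpace.measurable_eq]
        exact hΦ.comap_le

end WeakTopology

noncomputable section MeasureValuedBranching

variable {E : Type u} [MeasurableSpace E]

/-- The class `B(E)⁺` of bounded nonnegative Borel functions. -/
structure IsBddBorelNonneg (f : E → ℝ) : Prop where
  measurable : Measurable f
  nonneg : ∀ x, 0 ≤ f x
  bdd : ∃ C : ℝ, ∀ x, f x ≤ C

/-- The Laplace functional `L_P(f) = ∫ exp(-ν(f)) P(dν)` of a measure `P` on `M(E)`. -/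
def laplaceFunctional (P : Measure (FiniteMeasure E)) (f : E → ℝ) : ℝ :=
  ∫ ν : FiniteMeasure E, Real.exp (-∫ x, f x ∂(ν : Measure E)) ∂P

/-- The Dirac measure at `x`, as an element of `M(E)`. -/
def diracFinite (x : E) : FiniteMeasure E := ⟨Measure.dirac x, inferInstance⟩

/-- `V_t f(x) = -log ∫ exp(-ν(f)) Q_t(δ_x, dν)`. -/
def cumulant (Q : ℝ → Kernel (FiniteMeasure E) (FiniteMeasure E)) (t : ℝ) (f : E → ℝ) (x : E) : ℝ :=
  -Real.log (laplaceFunctional (Q t (diracFinite x)) f)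

/-- `Q` (of which only the times `t ≥ 0` matter) is the conservative transition semigroup of a
measure-valued branching process: a semigroup of Markov kernels on `M(E)` with the branching
property `∫ exp(-ν(f)) Q_t(μ, dν) = exp(-μ(V_t f))`. As the left side is positive, that identity
contains the finiteness of `μ(V_t f)`. -/
structure IsMBSemigroup (Q : ℝ → Kernel (FiniteMeasure E) (FiniteMeasure E)) : Prop where
  markov : ∀ t, 0 ≤ t → IsMarkovKernel (Q t)
  zero : Q 0 = Kernel.id
  add : ∀ s t, 0 ≤ s → 0 ≤ t → Q (s + t) = Q t ∘ₖ Q s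
  branching : ∀ t, 0 ≤ t → ∀ (μ : FiniteMeasure E) (f : E → ℝ), IsBddBorelNonneg f →
    Integrable (cumulant Q t f) (μ : Measure E) ∧
    laplaceFunctional (Q t μ) f = Real.exp (-∫ x, cumulant Q t f x ∂(μ : Measure E))

/-- `V̄_t(x) = lim_{r → ∞} V_t r(x) ∈ [0, ∞]`, where `r` also denotes the constant function. Since
`V_t r(x)` increases with `r`, the limit is the supremum; see `tendsto_cumulantLimit`. -/
def cumulantLimit (Q : ℝ → Kernel (FiniteMeasure E) (FiniteMeasure E)) (t : ℝ) (x : E) : ℝ≥0∞ :=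
  ⨆ r : ℝ≥0, ENNReal.ofReal (cumulant Q t (fun _ => (r : ℝ)) x)

theorem tendsto_cumulantLimit {Q : ℝ → Kernel (FiniteMeasure E) (FiniteMeasure E)}
    (hQ : IsMBSemigroup Q) {t : ℝ} (ht : 0 ≤ t) (x : E) :
    Tendsto (fun r : ℝ≥0 => ENNReal.ofReal (cumulant Q t (fun _ => (r : ℝ)) x)) atTop
      (𝓝 (cumulantLimit Q t x)) := by
  refine tendsto_atTop_iSup fun a b hab => ENNReal.ofReal_le_ofReal (neg_le_neg ?_)
  have := hQ.markov t ht
  have hcoe : Measurable (fun μ : FiniteMeasure E => (μ : Measure E)) := measurable_subtype_coe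
  have hint : ∀ r : ℝ≥0, Integrable (fun ν : FiniteMeasure E =>
      Real.exp (-∫ _, (r : ℝ) ∂(ν : Measure E))) (Q t (diracFinite x)) := by
    intro r
    refine Integrable.of_bound (C := 1) ?_ (ae_of_all _ fun ν => ?_)
    · simp only [integral_const, Measure.real, smul_eq_mul]
      exact (Real.measurable_exp.comp (((Measure.measurable_coe MeasurableSet.univ).comp
        hcoe).ennreal_toReal.mul_const _).neg).aestronglyMeasurable
    · rw [Real.norm_eq_abs, Real.abs_exp, Real.exp_le_one_iff, neg_nonpos]
      exact integral_nonneg fun _ => r.2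
  refine Real.log_le_log ?_ (integral_mono (hint b) (hint a) fun ν => ?_)
  · exact integral_exp_pos (hint b)
  · refine Real.exp_le_exp.2 (neg_le_neg ?_)
    simp only [integral_const, smul_eq_mul]
    gcongr

/-- The `n`-fold convolution of a measure on `M(E)` with itself. -/
def convPower (P : Measure (FiniteMeasure E)) : ℕ → Measure (FiniteMeasure E)
  | 0 => Measure.dirac 0
  | n + 1 => (convPower P n).conv P

/-- Infinite divisibility of a probability measure on `M(E)`. -/
def IsInfinitelyDivisible (P : ProbabilityMeasure (FiniteMeasure E)) : Prop :=
  ∀ n : ℕ, 1 ≤ n → ∃ R : ProbabilityMeasure (FiniteMeasure E),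
    convPower (R : Measure (FiniteMeasure E)) n = P

/-- `(K_s)_{s > 0}` is an infinitely divisible probability entrance law for `(Q_t)`: the `K_s` are
infinitely divisible probability measures with `K_s Q_r = K_{s + r}`. Values of `K` at `s ≤ 0` do
not matter. -/
structure IsInfDivEntranceLaw (Q : ℝ → Kernel (FiniteMeasure E) (FiniteMeasure E))
    (K : ℝ → ProbabilityMeasure (FiniteMeasure E)) : Prop where
  infinitelyDivisible : ∀ s, 0 < s → IsInfinitelyDivisible (K s)
  entrance : ∀ s r, 0 < s → 0 ≤ r →
    (K s : Measure (FiniteMeasure E)).bind (Q r) = K (s + r)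

/-- `(N_t)_{t ≥ 0}` is a skew convolution semigroup associated with `(Q_t)`:
`N_{r + t} = (N_r Q_t) * N_t`. Values of `N` at `t < 0` do not matter. -/
def IsSkewConvolutionSemigroup (Q : ℝ → Kernel (FiniteMeasure E) (FiniteMeasure E))
    (N : ℝ → ProbabilityMeasure (FiniteMeasure E)) : Prop :=
  ∀ r t, 0 ≤ r → 0 ≤ t → (N (r + t) : Measure (FiniteMeasure E)) =
    ((N r : Measure (FiniteMeasure E)).bind (Q t)).conv (N t)

/-- `I_s(K, f) = -log L_{K_s}(f)`. -/
def entranceExponent (K : ℝ → ProbabilityMeasure (FiniteMeasure E)) (s : ℝ) (f : E → ℝ) : ℝ :=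
  -Real.log (laplaceFunctional (K s : Measure (FiniteMeasure E)) f)

/-- `N` is represented by `K`: for all `t ≥ 0` and `f ∈ B(E)⁺`, the integral of the nonnegative
function `s ↦ I_s(K, f)` over `(0, t]` exists and is finite, and
`L_{N_t}(f) = exp(-∫_0^t I_s(K, f) ds)`. -/
def IsRepresentedBy (N K : ℝ → ProbabilityMeasure (FiniteMeasure E)) : Prop :=
  ∀ t, 0 ≤ t → ∀ f : E → ℝ, IsBddBorelNonneg f →
    IntegrableOn (fun s => entranceExponent K s f) (Set.Ioc 0 t) ∧
    laplaceFunctional (N t : Measure (FiniteMeasure E)) f =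
      Real.exp (-∫ s in Set.Ioc 0 t, entranceExponent K s f)

/-- The total variation distance `‖P - R‖_var = |P - R|(M(E))`: the total mass of the total
variation measure of the signed measure `P - R`. -/
def varDist (P R : ProbabilityMeasure (FiniteMeasure E)) : ℝ≥0∞ :=
  ((P : Measure (FiniteMeasure E)).toSignedMeasure -
    (R : Measure (FiniteMeasure E)).toSignedMeasure).totalVariation Set.univ

end MeasureValuedBranching

/-! ### Comparing probability measures through a one-sided domination -/

section MeasureComparison

variable {α : Type*} [MeasurableSpace α]

/-! Under `Q t`, the process started from μ has died out by time t with probability exp(-μ(V̄_t)).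
In N_{r+t} = (N_r Q_t) * N_t, restricting to the event that the first summand is the zero measure
gives N_{r+t} ≥ p_r N_t, where p_r = (N_r Q_t){0} = ∫ exp(-ν(V̄_t)) N_r(dν)
(`bind_real_zero_mul_le`, `bind_real_singleton_zero`). If N_r → N_∞ on bounded measurable functions,
r → ∞ yields N_∞ ≥ p N_t with p = ∫ exp(-ν(V̄_t)) N_∞(dν). Between probability measures this
domination forces variation distance at most 2(1 - p) (`totalVariation_sub_le_of_smul_le`).

The same inequality produces the limit. Let V̄_1 ≤ C and Φ(t) = ∫_0^t I_u(K, C) du. For 1 ≤ s ≤ t,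
running the last unit of time of Q_s separately bounds (N_{t-s} Q_s){0} below by the Laplace
functional of N_{t-s} Q_{s-1} at C, which is exp(Φ(s-1) - Φ(t-1)). Jensen's inequality and the
moment condition make Φ converge to some L, so the measures exp(Φ(s-1) - L) N_s increase in s, with
total mass tending to 1. Their supremum is N_∞ (`exists_dominating_limit`). -/

theorem exists_measure_eq_iSup {μ : ℕ → Measure α} (hμ : Monotone μ) :
    ∃ ν : Measure α, ∀ s, MeasurableSet s → ν s = ⨆ n, μ n s := by
  refine ⟨Measure.ofMeasurable (fun s _ => ⨆ n, μ n s) (by simp) ?_, fun s hs => ?_⟩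
  · intro f hf hd
    simp_rw [measure_iUnion hd hf, ← lintegral_count]
    rw [lintegral_iSup (fun n => measurable_of_countable _)]
    exact fun m n hmn i => hμ hmn _
  · rw [Measure.ofMeasurable_apply _ hs]

/-- Domination controls only P - R from above; since both masses are 1, passing to the complement of
`A` gives the other sign. -/
theorem measureReal_sub_le_of_smul_le {P R : Measure α} [IsProbabilityMeasure P]
    [IsProbabilityMeasure R] {d : ℝ} (hd1 : d ≤ 1)
    (h : ∀ A, MeasurableSet A → d * P.real A ≤ R.real A) {A : Set α} (hA : MeasurableSet A) :
    |P.real A - R.real A| ≤ 1 - d := by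
  have key : ∀ B, MeasurableSet B → P.real B - R.real B ≤ 1 - d := fun B hB => by
    have h1 := h B hB
    have h2 : P.real B ≤ 1 := measureReal_le_one
    nlinarith
  have h1 := key A hA
  have h2 := key Aᶜ hA.compl
  rw [probReal_compl_eq_one_sub hA, probReal_compl_eq_one_sub hA] at h2
  rw [abs_le]
  constructor <;> linarith

theorem totalVariation_sub_le_of_smul_le {P R : Measure α} [IsProbabilityMeasure P]
    [IsProbabilityMeasure R] {d : ℝ} (hd1 : d ≤ 1)
    (h : ∀ A, MeasurableSet A → d * P.real A ≤ R.real A) :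
    (P.toSignedMeasure - R.toSignedMeasure).totalVariation Set.univ ≤
      2 * ENNReal.ofReal (1 - d) := by
  set s := P.toSignedMeasure - R.toSignedMeasure with hs
  obtain ⟨i, hi₁, hi₂, hi₃, hpos, hneg⟩ := s.toJordanDecomposition_spec
  have hsA : ∀ A, MeasurableSet A → |s A| ≤ 1 - d := fun A hA => by
    rw [hs, Measure.toSignedMeasure_sub_apply hA]
    exact measureReal_sub_le_of_smul_le hd1 h hA
  -- Each Jordan part has as its mass the absolute value of `s` on one Hahn set, hence at most 1 -
  -- d; the two parts give the factor 2.
  rw [SignedMeasure.totalVariation, Measure.add_apply, hpos, hneg, two_mul]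
  refine add_le_add ?_ ?_
  · rw [← ofReal_measureReal, SignedMeasure.toMeasureOfZeroLE_real_apply _ _ _ .univ]
    refine ENNReal.ofReal_le_ofReal ((le_abs_self _).trans (hsA _ (hi₁.inter .univ)))
  · rw [← ofReal_measureReal, SignedMeasure.toMeasureOfLEZero_real_apply _ _ _ .univ]
    refine ENNReal.ofReal_le_ofReal ((neg_le_abs _).trans (hsA _ (hi₁.compl.inter .univ)))

theorem abs_integral_sub_le_of_smul_le {P R : Measure α} [IsProbabilityMeasure P]
    [IsProbabilityMeasure R] {d : ℝ} (hd0 : 0 ≤ d) (hd1 : d ≤ 1)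
    (h : ∀ A, MeasurableSet A → d * P.real A ≤ R.real A) {F : α → ℝ} (hF : Measurable F) {B : ℝ}
    (hB : ∀ x, |F x| ≤ B) :
    |(∫ x, F x ∂P) - ∫ x, F x ∂(R : Measure α)| ≤ 2 * B * (1 - d) := by
  have hle : ENNReal.ofReal d • P ≤ R := by
    refine Measure.le_iff.2 fun A hA => ?_
    rw [Measure.smul_apply, smul_eq_mul, ← ofReal_measureReal (μ := P),
      ← ofReal_measureReal (μ := R), ← ENNReal.ofReal_mul hd0]
    exact ENNReal.ofReal_le_ofReal (h A hA)
  have hfin : IsFiniteMeasure (ENNReal.ofReal d • P) := ⟨by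
    simp [ENNReal.ofReal_lt_top]⟩
  have hint : ∀ (μ : Measure α) [IsFiniteMeasure μ] , Integrable F μ := fun μ _ =>
    Integrable.of_bound hF.aestronglyMeasurable B (ae_of_all _ hB)
  -- R = S + dP with `S` positive of mass 1 - d, so P - R = (1 - d)P - S, and each term contributes
  -- at most B(1 - d).
  set S : Measure α := R - ENNReal.ofReal d • P with hS
  have hSR : S + ENNReal.ofReal d • P = R := Measure.sub_add_cancel_of_le hle
  have hSfin : IsFiniteMeasure S := isFiniteMeasure_of_le R Measure.sub_le
  have hR : ∫ x, F x ∂(R : Measure α) = (∫ x, F x ∂S) + d * ∫ x, F x ∂P := by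
    conv_lhs => rw [← hSR]
    rw [integral_add_measure (hint _) (hint _), integral_smul_measure,
      ENNReal.toReal_ofReal hd0, smul_eq_mul]
  have hmass : S.real Set.univ = 1 - d := by
    have : R.real Set.univ = S.real Set.univ + d * P.real Set.univ := by
      conv_lhs => rw [← hSR]
      rw [measureReal_add_apply, measureReal_ennreal_smul_apply, ENNReal.toReal_ofReal hd0]
    rw [probReal_univ (μ := R), probReal_univ (μ := P)] at this
    linarith
  have hIS : |∫ x, F x ∂S| ≤ B * (1 - d) := by
    rw [← hmass]
    exact norm_integral_le_of_norm_le_const (f := F) (ae_of_all _ hB)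
  have hIP : |∫ x, F x ∂P| ≤ B := by
    simpa using norm_integral_le_of_norm_le_const (μ := P) (f := F) (ae_of_all _ hB)
  have : (∫ x, F x ∂P) - ∫ x, F x ∂(R : Measure α) = (1 - d) * (∫ x, F x ∂P) - ∫ x, F x ∂S := by rw [hR]; ring
  rw [this]
  refine (abs_sub _ _).trans ?_
  rw [abs_mul, abs_of_nonneg (sub_nonneg.2 hd1)]
  nlinarith

/-- A family of probability measures that increases up to a convergent bounded positive weight
converges, uniformly on measurable sets, to a probability measure. -/
theorem exists_limit_of_weighted_monotone {P : ℝ → ProbabilityMeasure α} {φ : ℝ → ℝ} {L : ℝ}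
    (hφ : Tendsto φ atTop (𝓝 L)) {t₀ : ℝ}
    (h : ∀ s t, t₀ ≤ s → s ≤ t → ∀ A, MeasurableSet A →
      Real.exp (φ s - φ t) * (P s : Measure α).real A ≤ (P t : Measure α).real A) :
    ∃ R : ProbabilityMeasure α, ∀ s, t₀ ≤ s → ∀ A, MeasurableSet A →
      Real.exp (φ s - L) * (P s : Measure α).real A ≤ (R : Measure α).real A := by
  -- Normalising by the limit `L` makes the weighted measures increasing with masses tending to 1.
  -- Integer times suffice: any s is bounded above by some t₀ + n.
  let μ : ℕ → Measure α := fun n =>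
    ENNReal.ofReal (Real.exp (φ (t₀ + n) - L)) • (P (t₀ + n) : Measure α)
  have hμA : ∀ n A, μ n A =
      ENNReal.ofReal (Real.exp (φ (t₀ + n) - L) * (P (t₀ + n) : Measure α).real A) := fun n A => by
    rw [ENNReal.ofReal_mul (Real.exp_nonneg _), ofReal_measureReal]; rfl
  have hstep : ∀ s t, t₀ ≤ s → s ≤ t → ∀ A, MeasurableSet A →
      Real.exp (φ s - L) * (P s : Measure α).real A ≤
        Real.exp (φ t - L) * (P t : Measure α).real A := fun s t hs hst A hA => by
    have : Real.exp (φ s - L) = Real.exp (φ t - L) * Real.exp (φ s - φ t) := by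
      rw [← Real.exp_add]; ring_nf
    rw [this, mul_assoc]
    exact mul_le_mul_of_nonneg_left (h s t hs hst A hA) (Real.exp_nonneg _)
  have hmono : Monotone μ := fun m n hmn => by
    refine Measure.le_iff.2 fun A hA => ?_
    rw [hμA, hμA]
    exact ENNReal.ofReal_le_ofReal (hstep _ _ (by simp) (by gcongr) A hA)
  obtain ⟨ν, hν⟩ := exists_measure_eq_iSup hmono
  have hν1 : ν Set.univ = 1 := by
    rw [hν _ .univ]
    refine tendsto_nhds_unique (tendsto_atTop_iSup fun m n hmn => hmono hmn Set.univ) ?_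
    simp_rw [hμA, probReal_univ, mul_one]
    have h1 : Tendsto (fun n : ℕ => φ (t₀ + n) - L) atTop (𝓝 (L - L)) :=
      (hφ.comp (tendsto_atTop_add_const_left _ _ tendsto_natCast_atTop_atTop)).sub_const L
    have h2 := ENNReal.tendsto_ofReal ((Real.continuous_exp.tendsto _).comp h1)
    simpa using h2
  have hνp : IsProbabilityMeasure ν := ⟨hν1⟩
  refine ⟨⟨ν, hνp⟩, fun s hs A hA => ?_⟩
  obtain ⟨n, hn⟩ := exists_nat_ge (s - t₀)
  refine (hstep s (t₀ + n) hs (by linarith) A hA).trans ?_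
  change _ ≤ ν.real A
  rw [← ENNReal.ofReal_le_ofReal_iff measureReal_nonneg, ofReal_measureReal, ← hμA, hν A hA]
  exact le_iSup (fun n => μ n A) n

end MeasureComparison

/-! ### Laplace functionals at constants and the atom at the zero measure -/

section Laplace

variable {E : Type u} [MeasurableSpace E]

theorem measurable_finiteMeasure_eval {A : Set E} (hA : MeasurableSet A) :
    Measurable fun ν : FiniteMeasure E => (ν : Measure E) A :=
  (Measure.measurable_coe hA).comp measurable_subtype_coe

theorem measurable_finiteMeasure_add :
    Measurable fun p : FiniteMeasure E × FiniteMeasure E => p.1 + p.2 := by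
  refine Measurable.subtype_mk (Measure.measurable_of_measurable_coe _ fun A hA => ?_)
  exact ((measurable_finiteMeasure_eval hA).comp measurable_fst).add
    ((measurable_finiteMeasure_eval hA).comp measurable_snd)

theorem finiteMeasure_eq_zero_iff {ν : FiniteMeasure E} :
    ν = 0 ↔ (ν : Measure E) Set.univ = 0 := by
  rw [Measure.measure_univ_eq_zero, ← FiniteMeasure.toMeasure_zero,
    FiniteMeasure.toMeasure_injective.eq_iff]

theorem measurableSet_finiteMeasure_zero : MeasurableSet ({0} : Set (FiniteMeasure E)) := by
  have : ({0} : Set (FiniteMeasure E)) = (fun ν : FiniteMeasure E => (ν : Measure E) Set.univ) ⁻¹' {0} := by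
    ext ν; simp [finiteMeasure_eq_zero_iff]
  rw [this]
  exact measurable_finiteMeasure_eval .univ (measurableSet_singleton 0)

/-- The product set {0} × A is mapped into A by addition. -/
theorem measure_zero_mul_le_conv (P R : Measure (FiniteMeasure E)) [SFinite R]
    {A : Set (FiniteMeasure E)} (hA : MeasurableSet A) :
    P {0} * R A ≤ (P.conv R) A := by
  rw [Measure.conv, Measure.map_apply measurable_finiteMeasure_add hA, ← Measure.prod_prod]
  refine measure_mono ?_
  rintro ⟨μ, ν⟩ ⟨hμ, hν⟩
  obtain rfl : μ = 0 := hμ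
  simpa using hν

theorem laplaceFunctional_const (P : Measure (FiniteMeasure E)) (c : ℝ) :
    laplaceFunctional P (fun _ => c) =
      ∫ ν : FiniteMeasure E, Real.exp (-((ν : Measure E).real Set.univ * c)) ∂P := by
  simp [laplaceFunctional]

theorem measurable_exp_neg_mass_mul (c : ℝ) :
    Measurable fun ν : FiniteMeasure E => Real.exp (-((ν : Measure E).real Set.univ * c)) :=
  Real.measurable_exp.comp ((measurable_finiteMeasure_eval .univ).ennreal_toReal.mul_const c).neg

theorem exp_neg_mass_mul_le_one {c : ℝ} (hc : 0 ≤ c) (ν : FiniteMeasure E) :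
    Real.exp (-((ν : Measure E).real Set.univ * c)) ≤ 1 := by
  rw [Real.exp_le_one_iff, neg_nonpos]
  positivity

theorem integrable_exp_neg_mass_mul (P : Measure (FiniteMeasure E)) [IsFiniteMeasure P] {c : ℝ}
    (hc : 0 ≤ c) :
    Integrable (fun ν : FiniteMeasure E => Real.exp (-((ν : Measure E).real Set.univ * c))) P :=
  Integrable.of_bound (measurable_exp_neg_mass_mul c).aestronglyMeasurable 1
    (ae_of_all _ fun ν => by
      rw [Real.norm_eq_abs, Real.abs_exp]; exact exp_neg_mass_mul_le_one hc ν)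

theorem laplaceFunctional_const_pos (P : Measure (FiniteMeasure E)) [IsProbabilityMeasure P]
    {c : ℝ} (hc : 0 ≤ c) : 0 < laplaceFunctional P (fun _ => c) := by
  rw [laplaceFunctional_const]
  exact integral_exp_pos (integrable_exp_neg_mass_mul P hc)

theorem laplaceFunctional_const_le_one (P : Measure (FiniteMeasure E)) [IsProbabilityMeasure P]
    {c : ℝ} (hc : 0 ≤ c) : laplaceFunctional P (fun _ => c) ≤ 1 := by
  rw [laplaceFunctional_const]
  refine (integral_mono (integrable_exp_neg_mass_mul P hc) (integrable_const 1)
    (exp_neg_mass_mul_le_one hc)).trans ?_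
  simp

theorem laplaceFunctional_conv_const (P R : Measure (FiniteMeasure E)) [SFinite P] [SFinite R]
    (c : ℝ) : laplaceFunctional (P.conv R) (fun _ => c) =
      laplaceFunctional P (fun _ => c) * laplaceFunctional R (fun _ => c) := by
  simp_rw [laplaceFunctional_const]
  rw [Measure.conv, integral_map measurable_finiteMeasure_add.aemeasurable
    (measurable_exp_neg_mass_mul c).aestronglyMeasurable, ← integral_prod_mul]
  refine integral_congr_ae (ae_of_all _ fun p => ?_)
  simp only [FiniteMeasure.toMeasure_add]
  rw [measureReal_add_apply, ← Real.exp_add]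
  ring_nf

/-- exp(-nν(1)) converges boundedly to the indicator of ν = 0. -/
theorem tendsto_laplaceFunctional_const (P : Measure (FiniteMeasure E)) [IsProbabilityMeasure P] :
    Tendsto (fun n : ℕ => laplaceFunctional P (fun _ => (n : ℝ))) atTop (𝓝 (P.real {0})) := by
  simp_rw [laplaceFunctional_const]
  rw [← integral_indicator_one measurableSet_finiteMeasure_zero]
  refine tendsto_integral_of_dominated_convergence (fun _ => 1)
    (fun n => (measurable_exp_neg_mass_mul _).aestronglyMeasurable) (integrable_const 1)
    (fun n => ae_of_all _ fun ν => ?_) (ae_of_all _ fun ν => ?_)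
  · rw [Real.norm_eq_abs, Real.abs_exp]; exact exp_neg_mass_mul_le_one n.cast_nonneg ν
  · by_cases hν : ν = 0
    · simp [hν]
    · have h0 : 0 < (ν : Measure E).real Set.univ := by
        refine ENNReal.toReal_pos (fun h => hν (finiteMeasure_eq_zero_iff.2 h)) (by finiteness)
      rw [Set.indicator_of_notMem (by simpa using hν)]
      exact Real.tendsto_exp_neg_atTop_nhds_zero.comp
        (tendsto_natCast_atTop_atTop.const_mul_atTop h0)

/-- Jensen's inequality for the Laplace functional at a constant. -/
theorem ofReal_neg_log_laplaceFunctional_le (P : Measure (FiniteMeasure E))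
    [IsProbabilityMeasure P] {c : ℝ} (hc : 0 < c) :
    ENNReal.ofReal (-Real.log (laplaceFunctional P (fun _ => c))) ≤
      ENNReal.ofReal c * ∫⁻ ν : FiniteMeasure E, (ν : Measure E) Set.univ ∂P := by
  set m := ∫⁻ ν : FiniteMeasure E, (ν : Measure E) Set.univ ∂P with hm
  rcases eq_or_ne m ∞ with h | h
  · rw [h, ENNReal.mul_top (by simpa using hc)]
    exact le_top
  have hmeas := measurable_finiteMeasure_eval (E := E) .univ
  have hint : Integrable (fun ν : FiniteMeasure E => (ν : Measure E).real Set.univ) P :=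
    integrable_toReal_of_lintegral_ne_top hmeas.aemeasurable h
  have hI : ∫ ν : FiniteMeasure E, (ν : Measure E).real Set.univ ∂P = m.toReal := by
    rw [hm, ← integral_toReal hmeas.aemeasurable (ae_of_all _ fun ν => by finiteness)]
    rfl
  rw [← ENNReal.ofReal_toReal h, ← ENNReal.ofReal_mul hc.le]
  refine ENNReal.ofReal_le_ofReal (neg_le.1 ?_)
  rw [Real.le_log_iff_exp_le (laplaceFunctional_const_pos P hc.le), laplaceFunctional_const]
  set a := c * m.toReal with ha
  -- The integrand is the tangent line of exp at -a, evaluated at -cν(1). Since cν(1) has mean a, it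
  -- integrates to exp(-a).
  calc Real.exp (-a)
      = ∫ ν : FiniteMeasure E, Real.exp (-a) * (1 + a - (ν : Measure E).real Set.univ * c) ∂P := by
        rw [integral_const_mul, integral_sub (integrable_const _) (hint.mul_const c),
          integral_mul_const, hI]
        simp [ha, mul_comm]
    _ ≤ _ := by
        refine integral_mono (((integrable_const _).sub (hint.mul_const c)).const_mul _)
          (integrable_exp_neg_mass_mul P hc.le) fun ν => ?_
        have : Real.exp (-((ν : Measure E).real Set.univ * c)) =
            Real.exp (-a) * Real.exp (a - (ν : Measure E).real Set.univ * c) := by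
          rw [← Real.exp_add]; ring_nf
        simp only [this]
        gcongr
        linarith [Real.add_one_le_exp (a - (ν : Measure E).real Set.univ * c)]

end Laplace

/-! ### Extinction probabilities and the skew convolution inequality -/

section Branching

variable {E : Type u} [MeasurableSpace E]

theorem isBddBorelNonneg_const {c : ℝ} (hc : 0 ≤ c) : IsBddBorelNonneg fun _ : E => c :=
  ⟨measurable_const, fun _ => hc, c, fun _ => le_rfl⟩

theorem lintegral_cumulantLimit_le {Q : ℝ → Kernel (FiniteMeasure E) (FiniteMeasure E)} {t : ℝ}
    {C : ℝ≥0} (hC : ∀ x, cumulantLimit Q t x ≤ C) (μ : FiniteMeasure E) :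
    ∫⁻ x, cumulantLimit Q t x ∂(μ : Measure E) ≤ C * (μ : Measure E) Set.univ :=
  (lintegral_mono hC).trans (lintegral_const _).le

/-- The extinction probability of a measure-valued branching process started from `μ`. -/
theorem IsMBSemigroup.real_singleton_zero {Q : ℝ → Kernel (FiniteMeasure E) (FiniteMeasure E)}
    (hQ : IsMBSemigroup Q) {t : ℝ} (ht : 0 ≤ t) {C : ℝ≥0} (hC : ∀ x, cumulantLimit Q t x ≤ C)
    (μ : FiniteMeasure E) :
    (Q t μ).real {0} = Real.exp (-(∫⁻ x, cumulantLimit Q t x ∂(μ : Measure E)).toReal) := by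
  have := hQ.markov t ht
  refine tendsto_nhds_unique (tendsto_laplaceFunctional_const (Q t μ)) ?_
  have hb := fun n : ℕ => hQ.branching t ht μ _ (isBddBorelNonneg_const (E := E) n.cast_nonneg)
  simp_rw [fun n => (hb n).2]
  have hnonneg : ∀ (n : ℕ) x, 0 ≤ cumulant Q t (fun _ => (n : ℝ)) x := fun n x =>
    neg_nonneg.2 (Real.log_nonpos (laplaceFunctional_const_pos _ n.cast_nonneg).le
      (laplaceFunctional_const_le_one _ n.cast_nonneg))
  have hI : ∀ n : ℕ, ∫ x, cumulant Q t (fun _ => (n : ℝ)) x ∂(μ : Measure E) =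
      (∫⁻ x, ENNReal.ofReal (cumulant Q t (fun _ => (n : ℝ)) x) ∂(μ : Measure E)).toReal :=
    fun n => integral_eq_lintegral_of_nonneg_ae (ae_of_all _ (hnonneg n))
      (hb n).1.aestronglyMeasurable
  simp_rw [hI]
  refine (Real.continuous_exp.tendsto _).comp (Tendsto.neg ?_)
  refine (ENNReal.tendsto_toReal (ne_top_of_le_ne_top (by finiteness)
    (lintegral_cumulantLimit_le hC μ))).comp ?_
  -- Only a.e. measurability of the cumulants is at hand, from their integrability in `branching`.
  -- The constant `C` dominates because V_t n ≤ V̄_t.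
  refine tendsto_lintegral_of_dominated_convergence' (fun _ => (C : ℝ≥0∞))
    (fun n => (hb n).1.aemeasurable.ennreal_ofReal) (fun n => ae_of_all _ fun x => ?_)
    (by rw [lintegral_const]; finiteness) (ae_of_all _ fun x => ?_)
  · have h := le_iSup (fun r : ℝ≥0 => ENNReal.ofReal (cumulant Q t (fun _ => (r : ℝ)) x)) (n : ℝ≥0)
    simp only [NNReal.coe_natCast] at h
    exact h.trans (hC x)
  · have h := (tendsto_cumulantLimit hQ ht x).comp (tendsto_natCast_atTop_atTop (R := ℝ≥0))
    simpa only [Function.comp_def, NNReal.coe_natCast] using h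

/-- V̄_t is an uncountable supremum not known to be measurable, so measurability in μ is read off
the kernel value Q_t(μ, {0}). -/
theorem IsMBSemigroup.measurable_extinction
    {Q : ℝ → Kernel (FiniteMeasure E) (FiniteMeasure E)}
    (hQ : IsMBSemigroup Q) {t : ℝ} (ht : 0 ≤ t) {C : ℝ≥0} (hC : ∀ x, cumulantLimit Q t x ≤ C) :
    Measurable fun μ : FiniteMeasure E =>
      Real.exp (-(∫⁻ x, cumulantLimit Q t x ∂(μ : Measure E)).toReal) := by
  simp_rw [← hQ.real_singleton_zero ht hC]
  exact (Kernel.measurable_coe _ measurableSet_finiteMeasure_zero).ennreal_toReal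

theorem exp_neg_toReal_le_one (a : ℝ≥0∞) : Real.exp (-a.toReal) ≤ 1 := by
  rw [Real.exp_le_one_iff, neg_nonpos]
  exact ENNReal.toReal_nonneg

theorem IsMBSemigroup.integrable_extinction
    {Q : ℝ → Kernel (FiniteMeasure E) (FiniteMeasure E)}
    (hQ : IsMBSemigroup Q) {t : ℝ} (ht : 0 ≤ t) {C : ℝ≥0} (hC : ∀ x, cumulantLimit Q t x ≤ C)
    (P : Measure (FiniteMeasure E)) [IsFiniteMeasure P] :
    Integrable (fun μ : FiniteMeasure E =>
      Real.exp (-(∫⁻ x, cumulantLimit Q t x ∂(μ : Measure E)).toReal)) P :=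
  Integrable.of_bound (hQ.measurable_extinction ht hC).aestronglyMeasurable 1
    (ae_of_all _ fun μ => by rw [Real.norm_eq_abs, Real.abs_exp]; exact exp_neg_toReal_le_one _)

theorem IsMBSemigroup.bind_real_singleton_zero
    {Q : ℝ → Kernel (FiniteMeasure E) (FiniteMeasure E)}
    (hQ : IsMBSemigroup Q) {t : ℝ} (ht : 0 ≤ t) {C : ℝ≥0} (hC : ∀ x, cumulantLimit Q t x ≤ C)
    (P : Measure (FiniteMeasure E)) [IsFiniteMeasure P] :
    (P.bind (Q t)).real {0} = ∫ μ : FiniteMeasure E,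
      Real.exp (-(∫⁻ x, cumulantLimit Q t x ∂(μ : Measure E)).toReal) ∂P := by
  have := hQ.markov t ht
  simp_rw [← hQ.real_singleton_zero ht hC]
  rw [Measure.real, Measure.bind_apply measurableSet_finiteMeasure_zero (Q t).aemeasurable,
    ← integral_toReal
      (Kernel.measurable_coe _ measurableSet_finiteMeasure_zero).aemeasurable
      (ae_of_all _ fun μ => by finiteness)]
  rfl

/-- Replaces the extinction probability by a Laplace functional at a constant, which the
representation by `K` computes explicitly. -/
theorem IsMBSemigroup.laplaceFunctional_le_bind_real_singleton_zero
    {Q : ℝ → Kernel (FiniteMeasure E) (FiniteMeasure E)}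
    (hQ : IsMBSemigroup Q) {t : ℝ} (ht : 0 ≤ t) {C : ℝ≥0} (hC : ∀ x, cumulantLimit Q t x ≤ C)
    (P : Measure (FiniteMeasure E)) [IsFiniteMeasure P] :
    laplaceFunctional P (fun _ => (C : ℝ)) ≤ (P.bind (Q t)).real {0} := by
  rw [hQ.bind_real_singleton_zero ht hC, laplaceFunctional_const]
  refine integral_mono (integrable_exp_neg_mass_mul P C.2) (hQ.integrable_extinction ht hC P)
    fun ν => ?_
  refine Real.exp_le_exp.2 (neg_le_neg ?_)
  refine (ENNReal.toReal_mono (by finiteness) (lintegral_cumulantLimit_le hC ν)).trans ?_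
  rw [ENNReal.toReal_mul, mul_comm]
  rfl

/-- The central inequality: keep only the event that the component N_r Q_t of N_{r+t} is extinct. -/
theorem IsSkewConvolutionSemigroup.bind_real_zero_mul_le
    {Q : ℝ → Kernel (FiniteMeasure E) (FiniteMeasure E)}
    {N : ℝ → ProbabilityMeasure (FiniteMeasure E)} (hQ : IsMBSemigroup Q)
    (hN : IsSkewConvolutionSemigroup Q N) {r t : ℝ} (hr : 0 ≤ r) (ht : 0 ≤ t)
    {A : Set (FiniteMeasure E)} (hA : MeasurableSet A) :
    ((N r : Measure (FiniteMeasure E)).bind (Q t)).real {0} *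
      (N t : Measure (FiniteMeasure E)).real A ≤ (N (r + t) : Measure (FiniteMeasure E)).real A := by
  have := hQ.markov t ht
  rw [Measure.real, Measure.real, ← ENNReal.toReal_mul]
  refine ENNReal.toReal_mono (by finiteness) ?_
  rw [hN r t hr ht]
  exact measure_zero_mul_le_conv _ _ hA

theorem entranceExponent_const_nonneg (K : ℝ → ProbabilityMeasure (FiniteMeasure E)) (s : ℝ)
    {c : ℝ} (hc : 0 ≤ c) : 0 ≤ entranceExponent K s (fun _ => c) :=
  neg_nonneg.2 (Real.log_nonpos (laplaceFunctional_const_pos _ hc).le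
    (laplaceFunctional_const_le_one _ hc))

/-- Laplace functionals turn convolution into a product, so N_r Q_s is obtained by dividing N_{r+s}
by N_s. -/
theorem laplaceFunctional_bind_const {Q : ℝ → Kernel (FiniteMeasure E) (FiniteMeasure E)}
    {N K : ℝ → ProbabilityMeasure (FiniteMeasure E)} (hQ : IsMBSemigroup Q)
    (hN : IsSkewConvolutionSemigroup Q N) (hNK : IsRepresentedBy N K) {r s c : ℝ} (hr : 0 ≤ r)
    (hs : 0 ≤ s) (hc : 0 ≤ c) :
    laplaceFunctional ((N r : Measure (FiniteMeasure E)).bind (Q s)) (fun _ => c) =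
      Real.exp ((∫ u in Set.Ioc 0 s, entranceExponent K u (fun _ => c)) -
        ∫ u in Set.Ioc 0 (r + s), entranceExponent K u (fun _ => c)) := by
  have := hQ.markov s hs
  have h1 := (hNK (r + s) (by positivity) _ (isBddBorelNonneg_const hc)).2
  rw [hN r s hr hs, laplaceFunctional_conv_const,
    (hNK s hs _ (isBddBorelNonneg_const hc)).2] at h1
  rw [sub_eq_add_neg, Real.exp_add, ← h1, mul_comm, mul_assoc, ← Real.exp_add]
  simp

/-- The integral is monotone in t, and Jensen bounds the integrand by c∫ν(1)K_u(dν), which is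
integrable over (0, ∞). -/
theorem tendsto_integral_entranceExponent {N K : ℝ → ProbabilityMeasure (FiniteMeasure E)}
    (hNK : IsRepresentedBy N K) {c : ℝ} (hc : 0 < c)
    (hmoment : ∫⁻ s in Set.Ioi (0 : ℝ), ∫⁻ ν : FiniteMeasure E, (ν : Measure E) Set.univ
      ∂(K s : Measure (FiniteMeasure E)) < ∞) :
    ∃ L, Tendsto (fun t => ∫ u in Set.Ioc 0 t, entranceExponent K u (fun _ => c)) atTop (𝓝 L) ∧
      ∀ t, ∫ u in Set.Ioc 0 t, entranceExponent K u (fun _ => c) ≤ L := by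
  set Φ := fun t : ℝ => ∫ u in Set.Ioc 0 t, entranceExponent K u (fun _ => c)
  have h0 := fun u => entranceExponent_const_nonneg K u hc.le
  have hint : ∀ t, IntegrableOn (fun s => entranceExponent K s fun _ => c) (Set.Ioc 0 t) :=
    fun t => (le_total 0 t).elim (fun ht => (hNK t ht _ (isBddBorelNonneg_const hc.le)).1)
      fun ht => by simp [Set.Ioc_eq_empty_of_le ht]
  have hmono : Monotone Φ := fun s t hst =>
    setIntegral_mono_set (hint t) (ae_of_all _ h0) (Set.Ioc_subset_Ioc_right hst).eventuallyLE
  have hbdd : BddAbove (Set.range Φ) := by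
    refine ⟨(ENNReal.ofReal c * ∫⁻ s in Set.Ioi (0 : ℝ), ∫⁻ ν : FiniteMeasure E,
      (ν : Measure E) Set.univ ∂(K s : Measure (FiniteMeasure E))).toReal, ?_⟩
    rintro _ ⟨t, rfl⟩
    simp only [Φ]
    rw [integral_eq_lintegral_of_nonneg_ae (ae_of_all _ h0) (hint t).aestronglyMeasurable]
    refine ENNReal.toReal_mono (ENNReal.mul_ne_top (by finiteness) hmoment.ne) ?_
    rw [← lintegral_const_mul' _ _ ENNReal.ofReal_ne_top]
    exact (lintegral_mono fun u => ofReal_neg_log_laplaceFunctional_le _ hc).trans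
      (lintegral_mono_set Set.Ioc_subset_Ioi_self)
  exact ⟨_, tendsto_atTop_ciSup hmono hbdd, fun t => le_ciSup hbdd t⟩

end Branching

/-! ### Existence of the limit and the variation bound -/

/-- The marginals `N_t` are, up to a factor tending to `1`, dominated by a limit law. -/
theorem exists_dominating_limit {E : Type u} [MeasurableSpace E]
    {Q : ℝ → Kernel (FiniteMeasure E) (FiniteMeasure E)} (hQ : IsMBSemigroup Q)
    {C : ℝ≥0} (hC : ∀ x, cumulantLimit Q 1 x ≤ C)
    {N K : ℝ → ProbabilityMeasure (FiniteMeasure E)} (hN : IsSkewConvolutionSemigroup Q N)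
    (hNK : IsRepresentedBy N K)
    (hmoment : ∫⁻ s in Set.Ioi (0 : ℝ), ∫⁻ ν : FiniteMeasure E, (ν : Measure E) Set.univ
      ∂(K s : Measure (FiniteMeasure E)) < ∞) :
    ∃ (R : ProbabilityMeasure (FiniteMeasure E)) (d : ℝ → ℝ), Tendsto d atTop (𝓝 1) ∧
      (∀ s, 0 ≤ d s ∧ d s ≤ 1) ∧ ∀ s, 1 ≤ s → ∀ A, MeasurableSet A →
        d s * (N s : Measure (FiniteMeasure E)).real A ≤ (R : Measure (FiniteMeasure E)).real A := by
  -- Jensen's bound is available for positive constants only, and enlarging `C` is harmless.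
  wlog hCpos : 0 < C generalizing C
  · exact this (C := C + 1) (fun x => (hC x).trans (by exact_mod_cast le_self_add)) (by positivity)
  obtain ⟨L, hL, hle⟩ := tendsto_integral_entranceExponent hNK (NNReal.coe_pos.2 hCpos) hmoment
  -- The shift by 1 accounts for the last unit of time, spent on extinction through V̄_1 ≤ C.
  set φ : ℝ → ℝ := fun t => ∫ u in Set.Ioc 0 (t - 1), entranceExponent K u (fun _ => (C : ℝ))
    with hφdef
  have hφ : Tendsto φ atTop (𝓝 L) := hL.comp (tendsto_atTop_add_const_right _ (-1) tendsto_id)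
  obtain ⟨R, hR⟩ := exists_limit_of_weighted_monotone (P := N) hφ (t₀ := 1)
    fun s t hs hst A hA => by
      have h := hN.bind_real_zero_mul_le hQ (sub_nonneg.2 hst) (zero_le_one.trans hs) hA
      rw [sub_add_cancel] at h
      refine (mul_le_mul_of_nonneg_right ?_ measureReal_nonneg).trans h
      have hs1 := sub_nonneg.2 hs
      have := hQ.markov _ hs1
      have hQs : Q s = Q 1 ∘ₖ Q (s - 1) := by
        rw [← hQ.add _ _ hs1 zero_le_one, sub_add_cancel]
      rw [hQs, ← Measure.comp_assoc]
      refine le_trans (le_of_eq ?_)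
        (hQ.laplaceFunctional_le_bind_real_singleton_zero zero_le_one hC _)
      rw [laplaceFunctional_bind_const hQ hN hNK (sub_nonneg.2 hst) hs1 C.coe_nonneg]
      simp only [hφdef]
      ring_nf
  refine ⟨R, fun s => Real.exp (φ s - L), ?_, fun s => ⟨Real.exp_nonneg _, ?_⟩, hR⟩
  · have := (Real.continuous_exp.tendsto _).comp (hφ.sub_const L)
    simpa [Function.comp_def] using this
  · rw [Real.exp_le_one_iff, sub_nonpos]
    exact hle _

theorem theorem4p10 {E : Type u} [TopologicalSpace E] [LusinSpace E] [MeasurableSpace E]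
    [BorelSpace E]
    (Q : ℝ → Kernel (FiniteMeasure E) (FiniteMeasure E)) (hQ : IsMBSemigroup Q)
    (hV : ∀ t : ℝ, 0 < t → ∃ C : ℝ≥0, ∀ x, cumulantLimit Q t x ≤ C)
    (K : ℝ → ProbabilityMeasure (FiniteMeasure E)) (hK : IsInfDivEntranceLaw Q K)
    (N : ℝ → ProbabilityMeasure (FiniteMeasure E)) (hN : IsSkewConvolutionSemigroup Q N)
    (hNK : IsRepresentedBy N K)
    (hmoment : ∫⁻ s in Set.Ioi (0 : ℝ), ∫⁻ ν : FiniteMeasure E, (ν : Measure E) Set.univ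
      ∂(K s : Measure (FiniteMeasure E)) < ∞) :
    ∃ Ninf : ProbabilityMeasure (FiniteMeasure E),
      Tendsto N atTop (𝓝 Ninf) ∧
      ∀ t : ℝ, 0 < t →
        varDist (N t) Ninf ≤
          2 * ∫⁻ ν : FiniteMeasure E, ENNReal.ofReal
            (1 - Real.exp (-(∫⁻ x, cumulantLimit Q t x ∂(ν : Measure E)).toReal))
            ∂(Ninf : Measure (FiniteMeasure E)) ∧
        2 * ∫⁻ ν : FiniteMeasure E, ENNReal.ofReal
            (1 - Real.exp (-(∫⁻ x, cumulantLimit Q t x ∂(ν : Measure E)).toReal))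
            ∂(Ninf : Measure (FiniteMeasure E)) ≤
          2 * ∫⁻ ν : FiniteMeasure E, ∫⁻ x, cumulantLimit Q t x ∂(ν : Measure E)
            ∂(Ninf : Measure (FiniteMeasure E)) := by
  obtain ⟨C₁, hC₁⟩ := hV 1 one_pos
  obtain ⟨R, d, hd, hd01, hdR⟩ := exists_dominating_limit hQ hC₁ hN hNK hmoment
  -- Convergence against all bounded measurable functions, stronger than weak convergence: it is
  -- applied below to indicators and to the extinction functional, neither assumed continuous.
  have hlim : ∀ (F : FiniteMeasure E → ℝ) (B : ℝ), Measurable F → (∀ ν, |F ν| ≤ B) →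
      Tendsto (fun s => ∫ ν, F ν ∂(N s : Measure (FiniteMeasure E))) atTop
        (𝓝 (∫ ν, F ν ∂(R : Measure (FiniteMeasure E)))) := by
    intro F B hF hB
    rw [tendsto_iff_dist_tendsto_zero]
    refine squeeze_zero' (.of_forall fun _ => dist_nonneg) ?_
      (g := fun s => 2 * B * (1 - d s)) ?_
    · filter_upwards [eventually_ge_atTop 1] with s hs
      exact abs_integral_sub_le_of_smul_le (hd01 s).1 (hd01 s).2 (hdR s hs) hF hB
    · simpa using (hd.const_sub 1).const_mul (2 * B)
  refine ⟨R, ?_, fun t ht => ⟨?_, ?_⟩⟩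
  · rw [ProbabilityMeasure.tendsto_iff_forall_integral_tendsto]
    exact fun f => hlim f ‖f‖ f.continuous.measurable fun ν => f.norm_coe_le_norm ν
  · obtain ⟨C, hC⟩ := hV t ht
    set p : FiniteMeasure E → ℝ := fun ν =>
      Real.exp (-(∫⁻ x, cumulantLimit Q t x ∂(ν : Measure E)).toReal) with hp
    have hpm : Measurable p := hQ.measurable_extinction ht.le hC
    have hp1 : ∀ ν, p ν ≤ 1 := fun ν => exp_neg_toReal_le_one _
    have hpi : ∀ (P : ProbabilityMeasure (FiniteMeasure E)),
        Integrable p (P : Measure (FiniteMeasure E)) :=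
      fun P => hQ.integrable_extinction ht.le hC P
    have hdom : ∀ A, MeasurableSet A → (∫ ν, p ν ∂(R : Measure (FiniteMeasure E))) *
        (N t : Measure (FiniteMeasure E)).real A ≤ (R : Measure (FiniteMeasure E)).real A := by
      intro A hA
      have h1 : Tendsto (fun r => (N (r + t) : Measure (FiniteMeasure E)).real A) atTop
          (𝓝 ((R : Measure (FiniteMeasure E)).real A)) := by
        have := hlim (A.indicator 1) 1 (measurable_one.indicator hA) fun ν => by
          by_cases h : ν ∈ A <;> simp [h]
        simp_rw [integral_indicator_one hA] at this
        exact this.comp (tendsto_atTop_add_const_right _ t tendsto_id)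
      have h2 := (hlim p 1 hpm fun ν => by
        rw [abs_of_nonneg (Real.exp_nonneg _)]; exact hp1 ν).mul_const
          ((N t : Measure (FiniteMeasure E)).real A)
      -- Let r → ∞ in (N_r Q_t){0} N_t(A) ≤ N_{r+t}(A).
      refine le_of_tendsto_of_tendsto h2 h1 ?_
      filter_upwards [eventually_ge_atTop 0] with r hr
      rw [hp, ← hQ.bind_real_singleton_zero ht.le hC]
      exact hN.bind_real_zero_mul_le hQ hr ht.le hA
    have hle1 : ∫ ν, p ν ∂(R : Measure (FiniteMeasure E)) ≤ 1 :=
      (integral_mono (hpi R) (integrable_const 1) hp1).trans (by simp)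
    refine (totalVariation_sub_le_of_smul_le hle1 hdom).trans_eq ?_
    have h := ofReal_integral_eq_lintegral_ofReal ((integrable_const 1).sub (hpi R))
      (ae_of_all _ fun ν => sub_nonneg.2 (hp1 ν))
    simp only [Pi.sub_apply] at h
    rw [← h, integral_sub (integrable_const 1) (hpi R)]
    simp
  · gcongr with ν
    -- This is 1 - exp(-a) ≤ a; at a = ∞, `toReal` gives 0 and the left side vanishes.
    refine ENNReal.ofReal_le_of_le_toReal ?_
    linarith [Real.add_one_le_exp (-(∫⁻ x, cumulantLimit Q t x ∂(ν : Measure E)).toReal)]
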